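/- **Theorem (HK1 in QEDFT).** Consider $N$ spin-$\tfrac12$ electrons of bare mass $m>0$ in a periodic box $\mathbb T=(\mathbb R/L\mathbb Z)^3$, coupled to the transverse photon modes $(\mathbf n,\lambda)$ with $\mathbf n\in\mathbb Z^3\setminus\{0\}$, $\lambda\in\{1,2\}$, $\mathbf k_{\mathbf n}=\tfrac{2\pi}{L}\mathbf n$, $|\mathbf k_{\mathbf n}|\le\Lambda$, $\omega_{\mathbf n}=c|\mathbf k_{\mathbf n}|$ with $c>0$, and real orthonormal polarization vectors $\boldsymbol\epsilon(\mathbf n,1),\boldsymbol\epsilon(\mathbf n,2)\perp\mathbf n$. Let $$\hat{\mathbf A}(\mathbf r)=\sqrt{\tfrac{4\pi}{L^3}}\sum_{\mathbf n,\lambda}\frac{\boldsymbol\epsilon(\mathbf n,\lambda)}{\sqrt{2\omega_{\mathbf n}}}\bigl(\hat a_{\mathbf n,\lambda}e^{i\mathbf k_{\mathbf n}\cdot\mathbf r}+\hat a^\dagger_{\mathbf n,\lambda}e^{-i\mathbf k_{\mathbf n}\cdot\mathbf r}\bigr),$$ $$H_0=\sum_{k=1}^N\frac1{2m}\bigl[\boldsymbol\sigma_k\cdot(-i\nabla_k+\hat{\mathbf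 A}(\mathbf r_k))\bigr]^2+\frac12\sum_{k\ne l}\sum_{\mathbf n\neq0}\frac{4\pi}{\mathbf k_{\mathbf n}^2}\frac{e^{i\mathbf k_{\mathbf n}\cdot(\mathbf r_k-\mathbf r_l)}}{L^3}+\sum_{\mathbf n,\lambda}\omega_{\mathbf n}\hat a^\dagger_{\mathbf n,\lambda}\hat a_{\mathbf n,\lambda}$$ on the tensor product of the antisymmetric $N$-electron space and the photon Fock space. For a measurable scalar potential $v:\mathbb T\to\mathbb R$ and an external transverse current $\mathbf J(\mathbf r)=\sqrt{\tfrac1{4\pi L^3}}\sum_{\mathbf n,\lambda}\sqrt{\tfrac{\omega_{\mathbf n}^3}{2}}\,\boldsymbol\epsilon(\mathbf n,\lambda)\bigl(J_{\mathbf n,\lambda}e^{i\mathbf k_{\mathbf n}\cdot\mathbf r}+J_{\mathbf n,\lambda}^*e^{-i\mathbf k_{\mathbf n}\cdot\mathbf r}\bigr)$ with $J_{\mathbf n,\lambda}\in\mathbb C$, let $$H[v,\mathbf J]=H_0+\sum_{k=1}^N v(\mathbf r_k)-\int_{\mathbb T}\mathbf J(\mathbf r)\cdot\hat{\mathbf A}(\mathbf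 r)\,d\mathbf r .$$ A density matrix is a positive operator $\Gamma$ of trace one on this space; $\rho_\Gamma$ is its one-particle density and $\mathbf A_\Gamma(\mathbf r)=\operatorname{tr}(\Gamma\hat{\mathbf A}(\mathbf r))$. It is a ground state of $H[v,\mathbf J]$ if it has finite energy (finite kinetic, Coulomb and photon energies and $\int|v|\rho_\Gamma<\infty$) and minimizes $\operatorname{tr}(H[v,\mathbf J]\Gamma')$, understood in the sense of quadratic forms, over all density matrices $\Gamma'$ of finite energy. Let $\Gamma_1$ be a ground state of $H[v_1,\mathbf J_1]$ and $\Gamma_2$ a ground state of $H[v_2,\mathbf J_2]$. If $\rho_{\Gamma_1}=\rho_{\Gamma_2}$ and $\mathbf A_{\Gamma_1}=\mathbf A_{\Gamma_2}$ almost everywhere, then $\Gamma_1$ is also a ground state of $H[v_2,\mathbf J_2]$ and $\Gamma_2$ is also a ground state of $H[v_1,\mathbf J_1]$. -/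

import Mathlib

open MeasureTheory

noncomputable section

/-- The positive square root of a positive bounded operator on a Hilbert space. -/
def positiveSqrt {H : Type*} [NormedAddCommGroup H] [InnerProductSpace ℂ H] [CompleteSpace H]
    (T : H →L[ℂ] H) : H →L[ℂ] H :=
  CFC.sqrt T

/-- The data of a system of `N` spin-1/2 electrons in a periodic box of side `L`, coupled to the
transverse photon modes of wave number at most `cutoff`: speed of light `c`, bare mass `m`, and two
real orthonormal polarization vectors, orthogonal to `n`, for every `n ≠ 0` in `ℤ³`
(atomic units). -/
structure PauliFierzSystem where
  N : ℕ
  L : ℝ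
  cutoff : ℝ
  c : ℝ
  m : ℝ
  pol : (Fin 3 → ℤ) → Fin 2 → EuclideanSpace ℝ (Fin 3)
  L_pos : 0 < L
  c_pos : 0 < c
  m_pos : 0 < m
  pol_orthonormal : ∀ n, n ≠ 0 → Orthonormal ℝ (pol n)
  pol_transverse : ∀ n, n ≠ 0 → ∀ l, ∑ j, (n j : ℝ) * pol n l j = 0

namespace PauliFierzSystem

variable (P : PauliFierzSystem)

instance : Fact (0 < P.L) := ⟨P.L_pos⟩

/-- The periodic box `(ℝ / Lℤ)³`; its `volume` has total mass `L³`. -/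
abbrev Torus : Type := Fin 3 → AddCircle P.L

/-- Positions `(r₁, …, r_N)` of the electrons. -/
abbrev Config : Type := Fin P.N → P.Torus

/-- The wave number `|k_n|` of the wave vector `k_n = (2π / L) n`. -/
def waveNumber (n : Fin 3 → ℤ) : ℝ :=
  2 * Real.pi / P.L * Real.sqrt (∑ j, (n j : ℝ) ^ 2)

/-- The photon modes `(n, λ)`, `n ≠ 0`, `|k_n| ≤ cutoff`. -/
abbrev Mode : Type := {n : Fin 3 → ℤ // n ≠ 0 ∧ P.waveNumber n ≤ P.cutoff} × Fin 2

theorem finite_wave_vectors :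
    {n : Fin 3 → ℤ | n ≠ 0 ∧ P.waveNumber n ≤ P.cutoff}.Finite := by
  have hk : 0 < 2 * Real.pi / P.L := div_pos (by positivity) P.L_pos
  set R : ℝ := P.cutoff / (2 * Real.pi / P.L) with hR
  refine (Set.Finite.pi' (fun _ : Fin 3 => Set.finite_Icc (-⌈R⌉) ⌈R⌉)).subset ?_
  rintro n ⟨-, hn⟩ j
  have h1 : Real.sqrt (∑ j, (n j : ℝ) ^ 2) ≤ R := by
    rw [hR, le_div_iff₀ hk, mul_comm]
    exact hn
  have h2 : |(n j : ℝ)| ≤ R := by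
    refine le_trans ?_ h1
    rw [← Real.sqrt_sq_eq_abs]
    exact Real.sqrt_le_sqrt
      (Finset.single_le_sum (f := fun i => (n i : ℝ) ^ 2) (fun i _ => sq_nonneg _)
        (Finset.mem_univ j))
  have h3 : |(n j : ℝ)| ≤ (⌈R⌉ : ℝ) := h2.trans (Int.le_ceil R)
  have h4 : |n j| ≤ ⌈R⌉ := by exact_mod_cast h3
  exact abs_le.mp h4

instance : Finite {n : Fin 3 → ℤ // n ≠ 0 ∧ P.waveNumber n ≤ P.cutoff} :=
  P.finite_wave_vectors.to_subtype

instance : Fintype P.Mode := Fintype.ofFinite _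

/-- The photon frequency `ω_n = c |k_n|`. -/
def omega (a : P.Mode) : ℝ := P.c * P.waveNumber a.1.1

/-- The plane wave `r ↦ exp(i k_n · r)` on the box. -/
def planeWave (n : Fin 3 → ℤ) : C(P.Torus, ℂ) where
  toFun r := ∏ j, fourier (n j) (r j)
  continuous_toFun := by fun_prop

/-- Spin indices of the electrons together with photon occupation numbers. -/
abbrev Label : Type := (Fin P.N → Fin 2) × (P.Mode → ℕ)

/-- The Hilbert space `L²((ℝ/Lℤ)^{3N}) ⊗ (ℂ²)^{⊗N} ⊗ Fock`, in the occupation number representation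
of the photon Fock space. The antisymmetry of the electrons is imposed by `IsAntisymmetric`. -/
abbrev Space : Type :=
  lp (fun _ : P.Label => Lp ℂ 2 (volume : Measure P.Config)) 2

/-- Families of component functions `ψ_{s,ν}(r₁, …, r_N)`. -/
abbrev Components : Type := P.Label → P.Config → ℂ

variable {P}

/-- The component functions of a vector of the Hilbert space. -/
def comp (ψ : P.Space) : P.Components := fun σ x => (ψ σ : P.Config → ℂ) x

/-- Antisymmetry under simultaneous permutation of the positions and spins of the electrons. -/
def IsAntisymmetric (ψ : P.Space) : Prop :=
  ∀ (π : Equiv.Perm (Fin P.N)) (s : Fin P.N → Fin 2) (ν : P.Mode → ℕ),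
    ∀ᵐ x : P.Config, comp ψ (s ∘ π, ν) (x ∘ π) = (Equiv.Perm.sign π : ℤ) * comp ψ (s, ν) x

/-- The annihilation operator of a mode. -/
def annihilate (a : P.Mode) (f : P.Components) : P.Components := fun σ x =>
  (Real.sqrt (σ.2 a + 1) : ℂ) * f (σ.1, σ.2 + Pi.single a 1) x

/-- The creation operator of a mode. -/
def create (a : P.Mode) (f : P.Components) : P.Components := fun σ x =>
  if σ.2 a = 0 then 0 else (Real.sqrt (σ.2 a) : ℂ) * f (σ.1, σ.2 - Pi.single a 1) x

/-- The `j`-th component of the quantized vector potential `Â(r)`, where the point `r` may depend on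
the configuration `x` of the electrons: `r x = x k` gives the operator `Â(r_k)`, and a constant `r`
gives the field operator at a fixed point. -/
def vectorPotential (j : Fin 3) (r : P.Config → P.Torus) (f : P.Components) : P.Components :=
  fun σ x => (Real.sqrt (4 * Real.pi / P.L ^ 3) : ℂ) *
    ∑ a : P.Mode, ((P.pol a.1.1 a.2 j / Real.sqrt (2 * P.omega a) : ℝ) : ℂ) *
      (P.planeWave a.1.1 (r x) * annihilate a f σ x +
        (starRingEnd ℂ) (P.planeWave a.1.1 (r x)) * create a f σ x)

/-- `g` is the weak partial derivative of `f` with respect to the `j`-th coordinate of the `k`-th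
electron on the torus, tested against all plane waves `exp(i ∑ₖ k_{nₖ} · rₖ)`. -/
def HasWeakDeriv (k : Fin P.N) (j : Fin 3) (f g : P.Config → ℂ) : Prop :=
  ∀ n : Fin P.N → Fin 3 → ℤ,
    ∫ x, (starRingEnd ℂ) (∏ l, P.planeWave (n l) (x l)) * g x =
      Complex.I * ((2 * Real.pi / P.L * n k j : ℝ) : ℂ) *
        ∫ x, (starRingEnd ℂ) (∏ l, P.planeWave (n l) (x l)) * f x

/-- Existence of the weak partial derivative in `L²`. -/
def WeaklyDifferentiable (k : Fin P.N) (j : Fin 3) (f : P.Config → ℂ) : Prop :=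
  ∃ g : Lp ℂ 2 (volume : Measure P.Config), HasWeakDeriv k j f g

open Classical in
/-- The weak partial derivative (only used where it exists). -/
def weakDeriv (k : Fin P.N) (j : Fin 3) (f : P.Config → ℂ) : P.Config → ℂ :=
  if h : WeaklyDifferentiable k j f then (h.choose : P.Config → ℂ) else 0

/-- The Pauli matrices. -/
def pauli : Fin 3 → Matrix (Fin 2) (Fin 2) ℂ :=
  ![!![0, 1; 1, 0], !![0, -Complex.I; Complex.I, 0], !![1, 0; 0, -1]]

/-- The operator `-i ∂_{k,j} + Â_j(r_k)`. -/
def covariantMomentum (k : Fin P.N) (j : Fin 3) (f : P.Components) : P.Components := fun σ x =>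
  -Complex.I * weakDeriv k j (f σ) x + vectorPotential j (fun y => y k) f σ x

/-- The operator `σ_k · (-i ∇_k + Â(r_k))`. -/
def pauliMomentum (k : Fin P.N) (f : P.Components) : P.Components := fun σ x =>
  ∑ j, ∑ t, pauli j (σ.1 k) t * covariantMomentum k j f (Function.update σ.1 k t, σ.2) x

/-- The squared norm `∑_{s,ν} ∫ |f_{s,ν}|²`. -/
def normSq (f : P.Components) : ENNReal := ∑' σ, ∫⁻ x, ‖f σ x‖ₑ ^ 2

/-- The inner product `∑_{s,ν} ∫ conj(f_{s,ν}) g_{s,ν}`. -/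
def innerProd (f g : P.Components) : ℂ := ∑' σ, ∫ x, (starRingEnd ℂ) (f σ x) * g σ x

/-- The kinetic energy `⟨ψ, ∑ₖ (1/2m) [σ_k · (-i ∇_k + Â(r_k))]² ψ⟩`. -/
def kineticEnergy (ψ : P.Space) : ENNReal :=
  ENNReal.ofReal (1 / (2 * P.m)) * ∑ k, normSq (pauliMomentum k (comp ψ))

/-- The photon energy `⟨ψ, ∑ ω a† a ψ⟩`. -/
def photonEnergy (ψ : P.Space) : ENNReal :=
  ∑' σ : P.Label, ENNReal.ofReal (∑ a, P.omega a * σ.2 a) * ∫⁻ x, ‖comp ψ σ x‖ₑ ^ 2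

variable (P) in
/-- The periodic Coulomb potential `∑_{n ≠ 0} (4π / k_n²) exp(i k_n · r) / L³`, a series which
converges in `L²` of the box. -/
def coulombPotential : Lp ℂ 2 (volume : Measure P.Torus) :=
  ∑' n : Fin 3 → ℤ, (if n = 0 then (0 : ℂ)
    else ((4 * Real.pi / P.waveNumber n ^ 2 / P.L ^ 3 : ℝ) : ℂ)) •
      ContinuousMap.toLp 2 (volume : Measure P.Torus) ℂ (P.planeWave n)

/-- The longitudinal interaction energy `W_C` of the electrons. -/
def coulombEnergy (x : P.Config) : ℝ :=
  1 / 2 * ∑ k, ∑ l, if k = l then 0 else (P.coulombPotential (x k - x l)).re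

/-- The probability density `∑_{s,ν} |ψ_{s,ν}(x)|²` of the positions. -/
def positionDensity (ψ : P.Space) (x : P.Config) : ENNReal := ∑' σ, ‖comp ψ σ x‖ₑ ^ 2

/-- The expectation value of the multiplication operator by `U`. -/
def multExpect (U : P.Config → ℝ) (ψ : P.Space) : ℝ :=
  ∫ x, U x * (positionDensity ψ x).toReal

/-- The expectation value of the multiplication operator by `|U|`. -/
def absMultExpect (U : P.Config → ℝ) (ψ : P.Space) : ENNReal :=
  ∫⁻ x, ‖U x‖ₑ * positionDensity ψ x

/-- The expectation value `⟨ψ, Â(r) ψ⟩`. -/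
def fieldExpect (ψ : P.Space) (r : P.Torus) : EuclideanSpace ℝ (Fin 3) :=
  WithLp.toLp 2 fun j => (innerProd (comp ψ) (vectorPotential j (fun _ => r) (comp ψ))).re

/-- The one-particle density `∑ₖ ∫ ∑_{s,ν} |ψ_{s,ν}(r₁, …, r_k = r, …, r_N)|² ∏_{l ≠ k} dr_l`; for
antisymmetric `ψ` all `N` summands are equal. -/
def oneParticleDensity (ψ : P.Space) (r : P.Torus) : ENNReal :=
  ∑ k, lmarginal (fun _ => volume) (Finset.univ.erase k) (positionDensity ψ) (fun _ => r)

/-- The external potential energy `∑ₖ v(r_k)`. -/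
def externalEnergy (v : P.Torus → ℝ) (x : P.Config) : ℝ := ∑ k, v (x k)

/-- The quadratic form of `H₀`, which contains the kinetic, longitudinal and photon energies. -/
def internalForm (ψ : P.Space) : ℝ :=
  (kineticEnergy ψ).toReal + multExpect coulombEnergy ψ + (photonEnergy ψ).toReal

/-- The quadratic form of the Pauli–Fierz Hamiltonian
`H[v, J] = H₀ + ∑ₖ v(r_k) - ∫ J(r) · Â(r) dr`. -/
def hamiltonianForm (v : P.Torus → ℝ) (J : P.Torus → EuclideanSpace ℝ (Fin 3)) (ψ : P.Space) : ℝ :=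
  internalForm ψ + multExpect (externalEnergy v) ψ - ∫ r, inner ℝ (J r) (fieldExpect ψ r)

/-- The sum of the absolute values of the electronic and photonic energies. The coupling to an
external current needs no separate term: it is dominated by the norm and the photon energy. -/
def absEnergy (v : P.Torus → ℝ) (ψ : P.Space) : ENNReal :=
  kineticEnergy ψ + absMultExpect coulombEnergy ψ + photonEnergy ψ +
    absMultExpect (externalEnergy fun r => |v r|) ψ

/-- Transverse external charge currents below the momentum cutoff:
`J(r) = (4π L³)^{-1/2} ∑_{n,λ} (ω_n³/2)^{1/2} ε(n,λ) (J_{n,λ} exp(i k_n · r) + c.c.)`. -/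
def IsExternalCurrent (J : P.Torus → EuclideanSpace ℝ (Fin 3)) : Prop :=
  ∃ z : P.Mode → ℂ, ∀ r, J r = Real.sqrt (1 / (4 * Real.pi * P.L ^ 3)) •
    ∑ a : P.Mode, (Real.sqrt (P.omega a ^ 3 / 2) *
      (z a * P.planeWave a.1.1 r + (starRingEnd ℂ) (z a * P.planeWave a.1.1 r)).re) •
        P.pol a.1.1 a.2

section DensityMatrix

variable {ι : Type*} (b : HilbertBasis ι ℂ P.Space) (Γ : P.Space →L[ℂ] P.Space)

/-- Density matrices: positive operators of trace one on the antisymmetric subspace (regarded as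
operators on the whole space). Traces are computed in a Hilbert basis `b`; their values do not
depend on `b`. -/
def IsDensityMatrix : Prop :=
  Γ.IsPositive ∧ (∀ ψ, IsAntisymmetric (Γ ψ)) ∧ HasSum (fun i => (inner ℂ (b i) (Γ (b i))).re) 1

/-- The vectors `ψᵢ = Γ^{1/2} bᵢ`. They satisfy `Γ = ∑ᵢ |ψᵢ⟩⟨ψᵢ|`, so that
`tr(O Γ) = tr(Γ^{1/2} O Γ^{1/2}) = ∑ᵢ ⟨ψᵢ, O ψᵢ⟩`. -/
def sqrtVec (i : ι) : P.Space := positiveSqrt Γ (b i)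

/-- `Γ` has finite energy, i.e. `tr(H Γ)` is defined (in the sense of quadratic forms). -/
def HasFiniteEnergy (v : P.Torus → ℝ) : Prop :=
  (∀ i k j σ, WeaklyDifferentiable k j (comp (sqrtVec b Γ i) σ)) ∧
    ∑' i, absEnergy v (sqrtVec b Γ i) < ⊤

/-- The energy `tr(H[v, J] Γ)`. -/
def energy (v : P.Torus → ℝ) (J : P.Torus → EuclideanSpace ℝ (Fin 3)) : ℝ :=
  ∑' i, hamiltonianForm v J (sqrtVec b Γ i)

/-- `Γ` is a (mixed) ground state of `H[v, J]`: it attains the infimum of `tr(H[v, J] Γ')` over all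
density matrices `Γ'` of finite energy. -/
def IsGroundState (v : P.Torus → ℝ) (J : P.Torus → EuclideanSpace ℝ (Fin 3)) : Prop :=
  IsDensityMatrix b Γ ∧ HasFiniteEnergy b Γ v ∧
    ∀ Γ' : P.Space →L[ℂ] P.Space, IsDensityMatrix b Γ' → HasFiniteEnergy b Γ' v →
      energy b Γ v J ≤ energy b Γ' v J

/-- The one-particle density `ρ_Γ`. -/
def density (r : P.Torus) : ENNReal := ∑' i, oneParticleDensity (sqrtVec b Γ i) r

/-- The expectation value `A_Γ(r) = tr(Γ Â(r))` of the vector potential. -/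
def vectorPotentialExpect (r : P.Torus) : EuclideanSpace ℝ (Fin 3) :=
  ∑' i, fieldExpect (sqrtVec b Γ i) r

/-- The relation `Γ ↦ (ρ, A)`. -/
def Yields (ρ : P.Torus → ENNReal) (A : P.Torus → EuclideanSpace ℝ (Fin 3)) : Prop :=
  density b Γ =ᵐ[volume] ρ ∧ vectorPotentialExpect b Γ =ᵐ[volume] A

end DensityMatrix

end PauliFierzSystem

end

noncomputable section

namespace PauliFierzSystem

variable {P : PauliFierzSystem}

/-! The argument is that of Hohenberg and Kohn. For a state of finite energy, `energy` splits as
F(Γ) + ∫ v ρ_Γ - ∫ J · A_Γ, with F the sum of `internalForm`, independent of (v, J). If Γ₁ and Γ₂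
share (ρ, A), then testing the minimality of Γ₁ for (v₁, J₁) against Γ₂ cancels the external terms
and leaves F(Γ₁) ≤ F(Γ₂). Adding the terms of (v₂, J₂), again equal for both states, makes the
energy of Γ₁ at most that of Γ₂, which is minimal. Neither strict inequalities nor uniqueness enter.

The work lies in the splitting (`energy_eq`): `energy` is a real `tsum` of a combination of
integrals, so every piece has to be shown summable. The potential term reduces to ρ by Tonelli
(`lintegral_mul_density`). The current term reduces to A by dominated convergence
(`hasSum_integral_inner_fieldExpect`), based on a bound of the field by norm plus photon energy
(`exists_enorm_fieldExpect_le`). Admissibility of Γ₁ for v₂ also follows, since finite energy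
depends on v only through ∫ |v| ρ (`hasFiniteEnergy_iff`). -/

/-! ### Norms of components and the trace condition. -/

theorem measurable_comp (ψ : P.Space) (σ : P.Label) : Measurable (comp ψ σ) :=
  (Lp.stronglyMeasurable (ψ σ)).measurable

theorem normSq_comp (ψ : P.Space) : normSq (comp ψ) = ENNReal.ofReal (‖ψ‖ ^ 2) := by
  have h := lp.hasSum_norm (p := 2) (by norm_num) ψ
  simp only [ENNReal.toReal_ofNat, Real.rpow_ofNat] at h
  rw [← h.tsum_eq, ENNReal.ofReal_tsum_of_nonneg (fun _ => sq_nonneg _) h.summable]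
  refine tsum_congr fun σ => ?_
  rw [ENNReal.ofReal_pow (norm_nonneg _), ofReal_norm, Lp.enorm_def,
    eLpNorm_eq_lintegral_rpow_enorm_toReal (by norm_num) (by norm_num)]
  simp only [ENNReal.toReal_ofNat, one_div, ENNReal.rpow_ofNat]
  rw [← ENNReal.rpow_ofNat, ← ENNReal.rpow_mul]
  norm_num
  rfl

theorem normSq_comp_lt_top (ψ : P.Space) : normSq (comp ψ) < ⊤ := by
  rw [normSq_comp]; exact ENNReal.ofReal_lt_top

theorem norm_positiveSqrt_sq {H : Type*} [NormedAddCommGroup H] [InnerProductSpace ℂ H]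
    [CompleteSpace H] {T : H →L[ℂ] H} (hT : T.IsPositive) (x : H) :
    ‖positiveSqrt T x‖ ^ 2 = (inner ℂ x (T x)).re := by
  have h0 : (positiveSqrt T).IsPositive :=
    (ContinuousLinearMap.nonneg_iff_isPositive _).1 (CFC.sqrt_nonneg T)
  have h1 : positiveSqrt T (positiveSqrt T x) = T x := DFunLike.congr_fun
    (CFC.sqrt_mul_sqrt_self T ((ContinuousLinearMap.nonneg_iff_isPositive _).2 hT)) x
  rw [← h1, ← h0.isSelfAdjoint.isSymmetric.apply_clm x,
    ← inner_self_eq_norm_sq (𝕜 := ℂ)]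
  rfl

/-- Trace one enters the proof here: it makes the norm part of the field bound summable over the
basis. -/
theorem IsDensityMatrix.tsum_normSq {ι : Type*} {b : HilbertBasis ι ℂ P.Space}
    {Γ : P.Space →L[ℂ] P.Space} (h : IsDensityMatrix b Γ) :
    ∑' i, normSq (comp (sqrtVec b Γ i)) = 1 := by
  simp only [normSq_comp, sqrtVec, norm_positiveSqrt_sq h.1]
  rw [← ENNReal.ofReal_tsum_of_nonneg _ h.2.2.summable, h.2.2.tsum_eq, ENNReal.ofReal_one]
  intro i
  rw [← norm_positiveSqrt_sq h.1]
  positivity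

/-! ### The potential energy as a functional of the one-particle density. -/

theorem measurable_positionDensity (ψ : P.Space) : Measurable (positionDensity ψ) :=
  Measurable.tsum fun σ => (measurable_comp ψ σ).enorm.pow_const 2

theorem lintegral_positionDensity (ψ : P.Space) :
    ∫⁻ x, positionDensity ψ x = normSq (comp ψ) :=
  lintegral_tsum fun σ => ((measurable_comp ψ σ).enorm.pow_const 2).aemeasurable

theorem positionDensity_ae_lt_top (ψ : P.Space) : ∀ᵐ x, positionDensity ψ x < ⊤ :=
  ae_lt_top (measurable_positionDensity ψ)
    (by rw [lintegral_positionDensity]; exact (normSq_comp_lt_top ψ).ne)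

theorem quasiMeasurePreserving_position (k : Fin P.N) :
    Measure.QuasiMeasurePreserving (fun x : P.Config => x k) :=
  Measure.quasiMeasurePreserving_eval (fun _ : Fin P.N => (volume : Measure P.Torus)) k

theorem lintegral_position_mul_of_measurable {w : P.Torus → ENNReal} (hw : Measurable w)
    (k : Fin P.N) {p : P.Config → ENNReal} (hp : Measurable p) :
    ∫⁻ x, w (x k) * p x =
      ∫⁻ r, w r * lmarginal (fun _ => volume) (Finset.univ.erase k) p (fun _ => r) := by
  have hm : Measurable fun x : P.Config => w (x k) * p x :=
    (hw.comp (measurable_pi_apply k)).mul hp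
  change lintegral (Measure.pi fun _ => volume) _ = _
  rw [lintegral_eq_lmarginal_univ (fun _ => 0),
    lmarginal_erase _ hm (Finset.mem_univ k)]
  refine lintegral_congr fun r => ?_
  -- Integrating out every coordinate but `k` leaves a function of coordinate `k` alone, so the base
  -- point may be replaced by the constant one used in `oneParticleDensity`.
  have h1 : ∀ q : P.Config → ENNReal, lmarginal (fun _ => volume) (Finset.univ.erase k) q
      (Function.update (fun _ => 0) k r) =
      lmarginal (fun _ => volume) (Finset.univ.erase k) q (fun _ => r) := by
    intro q
    refine lmarginal_congr _ q fun i hi => ?_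
    obtain rfl : i = k := by simpa using hi
    simp
  rw [h1]
  have h2 : ∀ y, Function.updateFinset (fun _ : Fin P.N => r) (Finset.univ.erase k) y k = r := by
    intro y
    simp [Function.updateFinset]
  simp only [lmarginal, h2]
  exact lintegral_const_mul _ (hp.comp measurable_updateFinset)

/-- Null sets of the box pull back to null sets under `x ↦ x k`, so a measurable representative of
`w` can be used on both sides. -/
theorem lintegral_position_mul {w : P.Torus → ENNReal} (hw : AEMeasurable w)
    (k : Fin P.N) {p : P.Config → ENNReal} (hp : Measurable p) :
    ∫⁻ x, w (x k) * p x =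
      ∫⁻ r, w r * lmarginal (fun _ => volume) (Finset.univ.erase k) p (fun _ => r) := by
  have h1 : (fun x : P.Config => w (x k) * p x) =ᵐ[volume] fun x => hw.mk w (x k) * p x := by
    filter_upwards [(quasiMeasurePreserving_position k).ae_eq_comp hw.ae_eq_mk] with x hx
    simp only [Function.comp_apply] at hx
    rw [hx]
  rw [lintegral_congr_ae h1, lintegral_position_mul_of_measurable hw.measurable_mk k hp]
  refine lintegral_congr_ae ?_
  filter_upwards [hw.ae_eq_mk] with r hr
  rw [hr]

theorem measurable_oneParticleDensity (ψ : P.Space) : Measurable (oneParticleDensity ψ) :=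
  Finset.measurable_fun_sum _ fun _ _ => ((measurable_positionDensity ψ).lmarginal _).comp
    (measurable_pi_lambda _ fun _ => measurable_id)

theorem lintegral_mul_oneParticleDensity {w : P.Torus → ENNReal} (hw : AEMeasurable w)
    (ψ : P.Space) :
    ∫⁻ r, w r * oneParticleDensity ψ r = ∑ k, ∫⁻ x, w (x k) * positionDensity ψ x := by
  simp only [lintegral_position_mul hw _ (measurable_positionDensity ψ), oneParticleDensity,
    Finset.mul_sum]
  exact lintegral_finsetSum' _ fun k _ => hw.mul
    (((measurable_positionDensity ψ).lmarginal _).comp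
      (measurable_pi_lambda _ fun _ => measurable_id)).aemeasurable

theorem lintegral_mul_density {ι : Type*} [Countable ι] (b : HilbertBasis ι ℂ P.Space)
    (Γ : P.Space →L[ℂ] P.Space) {w : P.Torus → ENNReal} (hw : AEMeasurable w) :
    ∫⁻ r, w r * density b Γ r =
      ∑' i, ∫⁻ r, w r * oneParticleDensity (sqrtVec b Γ i) r := by
  simp only [density, ← ENNReal.tsum_mul_left]
  exact lintegral_tsum fun i => hw.mul (measurable_oneParticleDensity _).aemeasurable

theorem absMultExpect_externalEnergy_abs {v : P.Torus → ℝ} (hv : AEMeasurable v) (ψ : P.Space) :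
    absMultExpect (externalEnergy fun r => |v r|) ψ =
      ∫⁻ r, ‖v r‖ₑ * oneParticleDensity ψ r := by
  rw [lintegral_mul_oneParticleDensity hv.enorm]
  have h : ∀ x : P.Config, ‖externalEnergy (fun r => |v r|) x‖ₑ = ∑ k, ‖v (x k)‖ₑ := by
    intro x
    simp only [externalEnergy]
    rw [Real.enorm_of_nonneg (Finset.sum_nonneg fun _ _ => abs_nonneg _),
      ENNReal.ofReal_sum_of_nonneg fun _ _ => abs_nonneg _]
    simp [Real.enorm_eq_ofReal_abs]
  simp only [absMultExpect, h, Finset.sum_mul]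
  exact lintegral_finsetSum' _ fun k _ =>
    (hv.comp_quasiMeasurePreserving (quasiMeasurePreserving_position k)).enorm.mul
      (measurable_positionDensity ψ).aemeasurable

/-- The positive and negative parts of `v` are kept as lower integrals, so that the density enters
as an `ENNReal`-valued weight, with no conversion to a real function. -/
theorem multExpect_externalEnergy {v : P.Torus → ℝ} (hv : AEMeasurable v) {ψ : P.Space}
    (h : ∫⁻ r, ‖v r‖ₑ * oneParticleDensity ψ r < ⊤) :
    multExpect (externalEnergy v) ψ =
      (∫⁻ r, ENNReal.ofReal (v r) * oneParticleDensity ψ r).toReal -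
        (∫⁻ r, ENNReal.ofReal (-v r) * oneParticleDensity ψ r).toReal := by
  have hp := measurable_positionDensity ψ
  have hvk : ∀ k : Fin P.N, AEMeasurable fun x : P.Config => v (x k) := fun k =>
    hv.comp_quasiMeasurePreserving (quasiMeasurePreserving_position k)
  have hfin := positionDensity_ae_lt_top ψ
  rw [lintegral_mul_oneParticleDensity hv.enorm] at h
  have hk := fun k => ENNReal.sum_lt_top.1 h k (Finset.mem_univ k)
  have hint : ∀ k, Integrable fun x : P.Config => v (x k) * (positionDensity ψ x).toReal := by
    refine fun k => ⟨((hvk k).mul hp.ennreal_toReal.aemeasurable).aestronglyMeasurable, ?_⟩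
    refine lt_of_eq_of_lt (lintegral_congr_ae ?_) (hk k)
    filter_upwards [hfin] with x hx
    rw [enorm_mul, ← ofReal_norm (positionDensity ψ x).toReal,
      Real.norm_of_nonneg ENNReal.toReal_nonneg, ENNReal.ofReal_toReal hx.ne]
  have hpos : ∀ {w : ℝ}, ∀ {p : ENNReal}, p < ⊤ →
      ENNReal.ofReal (w * p.toReal) = ENNReal.ofReal w * p := by
    intro w p hp
    rw [ENNReal.ofReal_mul' ENNReal.toReal_nonneg, ENNReal.ofReal_toReal hp.ne]
  -- Stated for every `u` with |u| = |v| in order to serve both `v` and `-v`.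
  have hlt : ∀ u : P.Torus → ℝ, (∀ r, |u r| = |v r|) → ∀ k ∈ Finset.univ,
      ∫⁻ x : P.Config, ENNReal.ofReal (u (x k)) * positionDensity ψ x ≠ ⊤ := by
    refine fun u hu k _ => ne_top_of_le_ne_top (hk k).ne (lintegral_mono fun x => ?_)
    gcongr
    rw [Real.enorm_eq_ofReal_abs, ← hu]
    exact ENNReal.ofReal_le_ofReal (le_abs_self _)
  rw [lintegral_mul_oneParticleDensity hv.ennreal_ofReal,
    lintegral_mul_oneParticleDensity (w := fun r => ENNReal.ofReal (-v r)) hv.neg.ennreal_ofReal,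
    ENNReal.toReal_sum (hlt v fun _ => rfl),
    ENNReal.toReal_sum (hlt (fun r => -v r) fun _ => abs_neg _), ← Finset.sum_sub_distrib]
  simp only [multExpect, externalEnergy, Finset.sum_mul]
  rw [integral_finsetSum _ fun k _ => hint k]
  refine Finset.sum_congr rfl fun k _ => ?_
  rw [integral_eq_lintegral_pos_part_sub_lintegral_neg_part (hint k)]
  congr 2 <;> refine lintegral_congr_ae ?_ <;> filter_upwards [hfin] with x hx
  · rw [hpos hx]
  · rw [← neg_mul, hpos hx]

/-! ### Photon operators and the expectation value of the field. -/

theorem omega_pos (a : P.Mode) : 0 < P.omega a := by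
  refine mul_pos P.c_pos (mul_pos (div_pos (by positivity) P.L_pos) (Real.sqrt_pos.2 ?_))
  obtain ⟨j, hj⟩ := Function.ne_iff.1 a.1.2.1
  refine Finset.sum_pos' (fun _ _ => sq_nonneg _) ⟨j, Finset.mem_univ j, ?_⟩
  have : (a.1.1 j : ℝ) ≠ 0 := by exact_mod_cast hj
  positivity

/-- Square integrability of a family of component functions. -/
def IsL2 (f : P.Components) : Prop :=
  (∀ σ, AEStronglyMeasurable (f σ)) ∧ normSq f < ⊤

theorem isL2_comp (ψ : P.Space) : IsL2 (comp ψ) :=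
  ⟨fun σ => (measurable_comp ψ σ).aestronglyMeasurable, normSq_comp_lt_top ψ⟩

/-- Pointwise, a product is at most the square of the larger factor. This crude substitute for
Cauchy–Schwarz suffices, as only finiteness and a linear bound are needed. -/
theorem tsum_lintegral_enorm_conj_mul_le {f g : P.Components}
    (hf : ∀ σ, AEStronglyMeasurable (f σ)) :
    ∑' σ, ∫⁻ x, ‖(starRingEnd ℂ) (f σ x) * g σ x‖ₑ ≤ normSq f + normSq g := by
  rw [normSq, normSq, ← ENNReal.tsum_add]
  refine ENNReal.tsum_le_tsum fun σ => ?_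
  rw [← lintegral_add_left' ((hf σ).enorm.pow_const 2)]
  refine lintegral_mono fun x => ?_
  rw [enorm_mul, RCLike.enorm_conj]
  rcases le_total ‖f σ x‖ₑ ‖g σ x‖ₑ with h | h
  · refine le_trans ?_ le_add_self
    rw [pow_two]; gcongr
  · refine le_trans ?_ le_self_add
    rw [pow_two]; gcongr

theorem IsL2.integrable_conj_mul {f g : P.Components} (hf : IsL2 f) (hg : IsL2 g) (σ : P.Label) :
    Integrable fun x => (starRingEnd ℂ) (f σ x) * g σ x :=
  ⟨(RCLike.continuous_conj.comp_aestronglyMeasurable (hf.1 σ)).mul (hg.1 σ),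
    ((ENNReal.le_tsum σ).trans (tsum_lintegral_enorm_conj_mul_le hf.1)).trans_lt
      (ENNReal.add_lt_top.2 ⟨hf.2, hg.2⟩)⟩

theorem tsum_enorm_integral_conj_mul_le {f g : P.Components} (hf : IsL2 f) :
    ∑' σ, ‖∫ x, (starRingEnd ℂ) (f σ x) * g σ x‖ₑ ≤ normSq f + normSq g :=
  (ENNReal.tsum_le_tsum fun _ => enorm_integral_le_lintegral_enorm _).trans
    (tsum_lintegral_enorm_conj_mul_le hf.1)

theorem enorm_innerProd_le {f g : P.Components} (hf : IsL2 f) :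
    ‖innerProd f g‖ₑ ≤ normSq f + normSq g :=
  enorm_tsum_le_tsum_enorm.trans (tsum_enorm_integral_conj_mul_le hf)

theorem summable_of_tsum_enorm_lt_top {α E : Type*} [NormedAddCommGroup E] [CompleteSpace E]
    {f : α → E} (h : ∑' a, ‖f a‖ₑ < ⊤) : Summable f := by
  refine Summable.of_norm ?_
  simpa using ENNReal.summable_toReal h.ne

theorem innerProd_sum {α : Type*} [Fintype α] {f : P.Components} (hf : IsL2 f) (c : α → ℂ)
    {g : α → P.Components} (hg : ∀ a, IsL2 (g a)) :
    innerProd f (fun σ x => ∑ a, c a * g a σ x) = ∑ a, c a * innerProd f (g a) := by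
  have hs : ∀ a, Summable fun σ => c a * ∫ x, (starRingEnd ℂ) (f σ x) * g a σ x := fun a =>
    (summable_of_tsum_enorm_lt_top ((tsum_enorm_integral_conj_mul_le hf).trans_lt
      (ENNReal.add_lt_top.2 ⟨hf.2, (hg a).2⟩))).mul_left _
  simp only [innerProd, ← tsum_mul_left]
  rw [← Summable.tsum_finsetSum fun a _ => hs a]
  refine tsum_congr fun σ => ?_
  simp only [Finset.mul_sum, mul_left_comm _ (c _)]
  rw [integral_finsetSum _ fun a _ => (hf.integrable_conj_mul (hg a) σ).const_mul _]
  simp only [integral_const_mul]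

/-- The expectation value of the number of photons in a mode. -/
def photonNumber (a : P.Mode) (ψ : P.Space) : ENNReal :=
  ∑' σ : P.Label, (σ.2 a : ENNReal) * ∫⁻ x, ‖comp ψ σ x‖ₑ ^ 2

theorem photonNumber_le (a : P.Mode) (ψ : P.Space) :
    photonNumber a ψ ≤ ENNReal.ofReal (P.omega a)⁻¹ * photonEnergy ψ := by
  rw [photonNumber, photonEnergy, ← ENNReal.tsum_mul_left]
  refine ENNReal.tsum_le_tsum fun σ => ?_
  rw [← mul_assoc]
  gcongr
  rw [← ENNReal.ofReal_mul (inv_nonneg.2 (omega_pos a).le), ← ENNReal.ofReal_natCast]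
  refine ENNReal.ofReal_le_ofReal ?_
  rw [inv_mul_eq_div, le_div_iff₀ (omega_pos a), mul_comm]
  exact Finset.single_le_sum (f := fun a => P.omega a * (σ.2 a : ℝ))
    (fun a _ => mul_nonneg (omega_pos a).le (Nat.cast_nonneg _)) (Finset.mem_univ a)

theorem lintegral_enorm_sqrt_mul_sq (n : ℕ) (f : P.Config → ℂ) :
    ∫⁻ x, ‖(Real.sqrt n : ℂ) * f x‖ₑ ^ 2 = n * ∫⁻ x, ‖f x‖ₑ ^ 2 := by
  have h : ‖(Real.sqrt n : ℂ)‖ₑ ^ 2 = n := by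
    rw [← ofReal_norm, ← ENNReal.ofReal_pow (norm_nonneg _), Complex.norm_real, Real.norm_eq_abs,
      sq_abs, Real.sq_sqrt (Nat.cast_nonneg n), ENNReal.ofReal_natCast]
  simp only [enorm_mul, mul_pow, h]
  exact lintegral_const_mul' _ _ (ENNReal.natCast_ne_top n)

theorem addPhoton_injective (a : P.Mode) :
    Function.Injective fun σ : P.Label => (σ.1, σ.2 + Pi.single a 1) := by
  rintro ⟨s, ν⟩ ⟨t, μ⟩ h
  simpa using h

/-- Shifting the label by one photon turns each term into a term of `photonNumber`; the shift is
injective. -/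
theorem normSq_annihilate_le (a : P.Mode) (ψ : P.Space) :
    normSq (annihilate a (comp ψ)) ≤ photonNumber a ψ := by
  refine le_trans (le_of_eq ?_) (ENNReal.tsum_comp_le_tsum_of_injective (addPhoton_injective a) _)
  refine tsum_congr fun σ => ?_
  have h := lintegral_enorm_sqrt_mul_sq (σ.2 a + 1) (comp ψ (σ.1, σ.2 + Pi.single a 1))
  simpa [annihilate] using h

/-- The function vanishes on labels without a photon in mode `a`, so the sum may be reindexed by
adding one. The weight ν_a + 1 then gives the photon number plus the norm. -/
theorem normSq_create_le (a : P.Mode) (ψ : P.Space) :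
    normSq (create a (comp ψ)) ≤ photonNumber a ψ + normSq (comp ψ) := by
  rw [normSq, ← (addPhoton_injective a).tsum_eq, photonNumber, normSq, ← ENNReal.tsum_add]
  · refine ENNReal.tsum_le_tsum fun σ => le_of_eq ?_
    have h := lintegral_enorm_sqrt_mul_sq (σ.2 a + 1) (comp ψ σ)
    simpa [create, add_mul] using h
  · intro σ hσ
    have h : σ.2 a ≠ 0 := by
      intro h
      simp [create, h] at hσ
    refine ⟨(σ.1, σ.2 - Pi.single a 1), Prod.ext rfl ?_⟩
    funext b
    by_cases hb : b = a
    · subst hb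
      simp only [Pi.add_apply, Pi.sub_apply, Pi.single_eq_same]
      omega
    · simp [hb]

/-- The annihilation operators followed by the creation operators. -/
def ladder (s : P.Mode ⊕ P.Mode) : P.Components → P.Components :=
  Sum.elim annihilate create s

/-- The coefficients of `Â_j(r)` with respect to the annihilation and creation operators. -/
def fieldCoeff (j : Fin 3) (r : P.Torus) (s : P.Mode ⊕ P.Mode) : ℂ :=
  Sum.elim
    (fun a : P.Mode => (Real.sqrt (4 * Real.pi / P.L ^ 3) : ℂ) *
      (((P.pol a.1.1 a.2 j / Real.sqrt (2 * P.omega a) : ℝ) : ℂ) * P.planeWave a.1.1 r))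
    (fun a : P.Mode => (Real.sqrt (4 * Real.pi / P.L ^ 3) : ℂ) *
      (((P.pol a.1.1 a.2 j / Real.sqrt (2 * P.omega a) : ℝ) : ℂ) *
        (starRingEnd ℂ) (P.planeWave a.1.1 r))) s

theorem vectorPotential_eq (j : Fin 3) (r : P.Torus) (f : P.Components) :
    vectorPotential j (fun _ => r) f = fun σ x => ∑ s, fieldCoeff j r s * ladder s f σ x := by
  funext σ x
  simp only [Fintype.sum_sum_type, fieldCoeff, ladder, Sum.elim_inl, Sum.elim_inr,
    vectorPotential, Finset.mul_sum, ← Finset.sum_add_distrib]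
  exact Finset.sum_congr rfl fun _ _ => by ring

theorem continuous_fieldCoeff (j : Fin 3) (s : P.Mode ⊕ P.Mode) :
    Continuous fun r => fieldCoeff j r s := by
  cases s
  · exact continuous_const.mul (continuous_const.mul (ContinuousMap.continuous _))
  · exact continuous_const.mul (continuous_const.mul
      (RCLike.continuous_conj.comp (ContinuousMap.continuous _)))

theorem exists_normSq_ladder_le (s : P.Mode ⊕ P.Mode) :
    ∃ C : NNReal, ∀ ψ : P.Space,
      normSq (ladder s (comp ψ)) ≤ C * (normSq (comp ψ) + photonEnergy ψ) := by
  have h : ∀ a (ψ : P.Space), photonNumber a ψ + normSq (comp ψ) ≤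
      ((Real.toNNReal (P.omega a)⁻¹ + 1 : NNReal) : ENNReal) *
        (normSq (comp ψ) + photonEnergy ψ) := by
    intro a ψ
    rw [ENNReal.coe_add, add_mul]
    refine add_le_add ((photonNumber_le a ψ).trans ?_) (by simp)
    exact mul_le_mul_right le_add_self _
  rcases s with a | a
  · exact ⟨_, fun ψ => ((normSq_annihilate_le a ψ).trans le_self_add).trans (h a ψ)⟩
  · exact ⟨_, fun ψ => (normSq_create_le a ψ).trans (h a ψ)⟩

theorem isL2_ladder (s : P.Mode ⊕ P.Mode) {ψ : P.Space}
    (hψ : normSq (comp ψ) + photonEnergy ψ < ⊤) : IsL2 (ladder s (comp ψ)) := by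
  obtain ⟨C, hC⟩ := exists_normSq_ladder_le s
  refine ⟨fun σ => ?_, (hC ψ).trans_lt (ENNReal.mul_lt_top ENNReal.coe_lt_top hψ)⟩
  rcases s with a | a
  · exact ((measurable_comp ψ _).const_mul _).aestronglyMeasurable
  · exact (Measurable.ite (.const _) measurable_const
      ((measurable_comp ψ _).const_mul _)).aestronglyMeasurable

theorem fieldExpect_apply {ψ : P.Space} (hψ : normSq (comp ψ) + photonEnergy ψ < ⊤)
    (r : P.Torus) (j : Fin 3) :
    fieldExpect ψ r j =
      (∑ s, fieldCoeff j r s * innerProd (comp ψ) (ladder s (comp ψ))).re := by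
  rw [← innerProd_sum (isL2_comp ψ) _ fun s => isL2_ladder s hψ, ← vectorPotential_eq]
  rfl

theorem continuous_fieldExpect {ψ : P.Space} (hψ : normSq (comp ψ) + photonEnergy ψ < ⊤) :
    Continuous (fieldExpect ψ) := by
  refine (PiLp.continuous_toLp 2 _).comp (continuous_pi fun j => ?_)
  have h : (fun r => (innerProd (comp ψ) (vectorPotential j (fun _ => r) (comp ψ))).re) = _ :=
    funext fun r => fieldExpect_apply hψ r j
  rw [h]
  exact Complex.continuous_re.comp (continuous_finsetSum _ fun s _ =>
    (continuous_fieldCoeff j s).mul continuous_const)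

theorem exists_enorm_fieldExpect_le (P : PauliFierzSystem) :
    ∃ C : NNReal, ∀ ψ : P.Space, normSq (comp ψ) + photonEnergy ψ < ⊤ → ∀ r,
      ‖fieldExpect ψ r‖ₑ ≤ C * (normSq (comp ψ) + photonEnergy ψ) := by
  have hc : ∀ j (s : P.Mode ⊕ P.Mode), ∃ K : NNReal, ∀ r : P.Torus, ‖fieldCoeff j r s‖₊ ≤ K := by
    intro j s
    obtain ⟨K, hK⟩ := isCompact_univ.exists_bound_of_continuousOn
      (continuous_fieldCoeff (P := P) j s).continuousOn
    exact ⟨K.toNNReal, fun r => NNReal.le_toNNReal_of_coe_le (hK r trivial)⟩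
  choose K hK using hc
  choose C hC using exists_normSq_ladder_le (P := P)
  -- `K` bounds the coefficient; in `1 + C s`, the 1 comes from `normSq (comp ψ)` and `C s` from the
  -- ladder operator in `enorm_innerProd_le`.
  refine ⟨∑ j, ∑ s, K j s * (1 + C s), fun ψ hψ r => ?_⟩
  have h1 : fieldExpect ψ r = ∑ j, fieldExpect ψ r j • EuclideanSpace.single j (1 : ℝ) := by
    ext j
    simp [Pi.single_apply]
  rw [h1]
  refine (enorm_sum_le _ _).trans ?_
  push_cast
  simp only [Finset.sum_mul]
  refine Finset.sum_le_sum fun j _ => ?_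
  rw [enorm_smul, fieldExpect_apply hψ]
  have h2 : ‖EuclideanSpace.single j (1 : ℝ)‖ₑ = 1 := by
    rw [← ofReal_norm]; simp
  have h3 : ∀ z : ℂ, ‖z.re‖ₑ ≤ ‖z‖ₑ := fun z => by
    rw [← ofReal_norm, ← ofReal_norm]
    exact ENNReal.ofReal_le_ofReal (Complex.abs_re_le_norm z)
  rw [h2, mul_one]
  refine (h3 _).trans ((enorm_sum_le _ _).trans (Finset.sum_le_sum fun s _ => ?_))
  rw [enorm_mul, mul_assoc]
  refine mul_le_mul' (by exact_mod_cast hK j s r) ((enorm_innerProd_le (isL2_comp ψ)).trans ?_)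
  rw [add_mul, one_mul]
  exact add_le_add le_self_add (hC s ψ)

theorem IsExternalCurrent.continuous {J : P.Torus → EuclideanSpace ℝ (Fin 3)}
    (hJ : IsExternalCurrent J) : Continuous J := by
  obtain ⟨z, hz⟩ := hJ
  rw [funext hz]
  fun_prop

theorem hasSum_integral_inner_fieldExpect {ι : Type*} [Countable ι] (b : HilbertBasis ι ℂ P.Space)
    (Γ : P.Space →L[ℂ] P.Space)
    (hΓ : ∑' i, (normSq (comp (sqrtVec b Γ i)) + photonEnergy (sqrtVec b Γ i)) < ⊤)
    {J : P.Torus → EuclideanSpace ℝ (Fin 3)} (hJ : Continuous J) :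
    HasSum (fun i => ∫ r, inner ℝ (J r) (fieldExpect (sqrtVec b Γ i) r))
      (∫ r, inner ℝ (J r) (vectorPotentialExpect b Γ r)) := by
  obtain ⟨C, hC⟩ := exists_enorm_fieldExpect_le P
  obtain ⟨K, hK⟩ := isCompact_univ.exists_bound_of_continuousOn hJ.continuousOn
  have hi := fun i => (ENNReal.le_tsum i).trans_lt hΓ
  have hs := (ENNReal.summable_toReal hΓ.ne).mul_left (C : ℝ)
  have hb : ∀ i r, ‖fieldExpect (sqrtVec b Γ i) r‖ ≤
      C * (normSq (comp (sqrtVec b Γ i)) + photonEnergy (sqrtVec b Γ i)).toReal := by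
    intro i r
    have h := ENNReal.toReal_mono (ENNReal.mul_lt_top ENNReal.coe_lt_top (hi i)).ne
      (hC _ (hi i) r)
    simpa using h
  -- The dominating functions are constant in `r`, hence integrable on the box of finite volume, and
  -- summable in `i` by `hΓ`.
  refine hasSum_integral_of_dominated_convergence
    (fun i _ => K * (C * (normSq (comp (sqrtVec b Γ i)) + photonEnergy (sqrtVec b Γ i)).toReal))
    (fun i => (hJ.inner (continuous_fieldExpect (hi i))).aestronglyMeasurable)
    (fun i => .of_forall fun r => ?_) (.of_forall fun r => hs.mul_left K) ?_
    (.of_forall fun r => ?_)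
  · exact (norm_inner_le_norm _ _).trans
      (mul_le_mul (hK r trivial) (hb i r) (norm_nonneg _) ((norm_nonneg _).trans (hK r trivial)))
  · exact integrable_const _
  · exact (Summable.of_norm_bounded hs fun i => hb i r).hasSum.mapL (innerSL ℝ (J r))

/-! ### Splitting the total energy. -/

/-- The weak derivatives of all `Γ^{1/2} bᵢ` exist, and the kinetic, longitudinal and photon
energies of `Γ` are finite. -/
def HasFiniteInternalEnergy {ι : Type*} (b : HilbertBasis ι ℂ P.Space)
    (Γ : P.Space →L[ℂ] P.Space) : Prop :=
  (∀ i k j σ, WeaklyDifferentiable k j (comp (sqrtVec b Γ i) σ)) ∧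
    ∑' i, kineticEnergy (sqrtVec b Γ i) < ⊤ ∧
    ∑' i, absMultExpect coulombEnergy (sqrtVec b Γ i) < ⊤ ∧
    ∑' i, photonEnergy (sqrtVec b Γ i) < ⊤

theorem hasFiniteEnergy_iff {ι : Type*} [Countable ι] (b : HilbertBasis ι ℂ P.Space)
    (Γ : P.Space →L[ℂ] P.Space) {v : P.Torus → ℝ} (hv : AEMeasurable v) :
    HasFiniteEnergy b Γ v ↔
      HasFiniteInternalEnergy b Γ ∧ ∫⁻ r, ‖v r‖ₑ * density b Γ r < ⊤ := by
  simp only [HasFiniteEnergy, HasFiniteInternalEnergy, absEnergy, ENNReal.tsum_add,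
    ENNReal.add_lt_top, absMultExpect_externalEnergy_abs hv, lintegral_mul_density b Γ hv.enorm,
    and_assoc]

theorem abs_multExpect_le (U : P.Config → ℝ) {ψ : P.Space} (h : absMultExpect U ψ < ⊤) :
    |multExpect U ψ| ≤ (absMultExpect U ψ).toReal := by
  rw [← Real.norm_eq_abs, ← toReal_enorm]
  refine ENNReal.toReal_mono h.ne ((enorm_integral_le_lintegral_enorm _).trans
    (lintegral_mono fun x => ?_))
  rw [enorm_mul, ← ofReal_norm (positionDensity ψ x).toReal,
    Real.norm_of_nonneg ENNReal.toReal_nonneg]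
  gcongr
  exact ENNReal.ofReal_toReal_le

/-- The kinetic and photon terms are nonnegative; the Coulomb term has no definite sign and is
dominated by its absolute version. -/
theorem HasFiniteInternalEnergy.summable_internalForm {ι : Type*} {b : HilbertBasis ι ℂ P.Space}
    {Γ : P.Space →L[ℂ] P.Space} (h : HasFiniteInternalEnergy b Γ) :
    Summable fun i => internalForm (sqrtVec b Γ i) := by
  obtain ⟨-, hK, hC, hph⟩ := h
  refine ((ENNReal.summable_toReal hK.ne).add ?_).add (ENNReal.summable_toReal hph.ne)
  exact Summable.of_norm_bounded (ENNReal.summable_toReal hC.ne) fun i =>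
    abs_multExpect_le _ ((ENNReal.le_tsum i).trans_lt hC)

theorem hasSum_multExpect_externalEnergy {ι : Type*} [Countable ι] (b : HilbertBasis ι ℂ P.Space)
    (Γ : P.Space →L[ℂ] P.Space) {v : P.Torus → ℝ} (hv : AEMeasurable v)
    (h : ∫⁻ r, ‖v r‖ₑ * density b Γ r < ⊤) :
    HasSum (fun i => multExpect (externalEnergy v) (sqrtVec b Γ i))
      ((∫⁻ r, ENNReal.ofReal (v r) * density b Γ r).toReal -
        (∫⁻ r, ENNReal.ofReal (-v r) * density b Γ r).toReal) := by
  have hle : ∀ u : P.Torus → ℝ, AEMeasurable u → (∀ r, |u r| = |v r|) →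
      HasSum (fun i =>
        (∫⁻ r, ENNReal.ofReal (u r) * oneParticleDensity (sqrtVec b Γ i) r).toReal)
        (∫⁻ r, ENNReal.ofReal (u r) * density b Γ r).toReal := by
    intro u hu huv
    have hlt : ∫⁻ r, ENNReal.ofReal (u r) * density b Γ r ≠ ⊤ := by
      refine ne_top_of_le_ne_top h.ne (lintegral_mono fun r => ?_)
      gcongr
      rw [Real.enorm_eq_ofReal_abs, ← huv]
      exact ENNReal.ofReal_le_ofReal (le_abs_self _)
    rw [lintegral_mul_density b Γ hu.ennreal_ofReal] at hlt ⊢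
    rw [ENNReal.tsum_toReal_eq (ENNReal.ne_top_of_tsum_ne_top hlt)]
    exact ENNReal.hasSum_toReal hlt
  rw [lintegral_mul_density b Γ hv.enorm] at h
  simp only [fun i => multExpect_externalEnergy hv ((ENNReal.le_tsum i).trans_lt h)]
  exact (hle v hv fun _ => rfl).sub (hle _ hv.neg fun _ => abs_neg _)

theorem energy_eq {ι : Type*} [Countable ι] {b : HilbertBasis ι ℂ P.Space}
    {Γ : P.Space →L[ℂ] P.Space} {v : P.Torus → ℝ} (hv : AEMeasurable v)
    {J : P.Torus → EuclideanSpace ℝ (Fin 3)} (hJ : IsExternalCurrent J)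
    (hΓ : IsDensityMatrix b Γ) (h : HasFiniteEnergy b Γ v) :
    energy b Γ v J = ∑' i, internalForm (sqrtVec b Γ i) +
      ((∫⁻ r, ENNReal.ofReal (v r) * density b Γ r).toReal -
        (∫⁻ r, ENNReal.ofReal (-v r) * density b Γ r).toReal) -
      ∫ r, inner ℝ (J r) (vectorPotentialExpect b Γ r) := by
  obtain ⟨hi, hvρ⟩ := (hasFiniteEnergy_iff b Γ hv).1 h
  have hS : ∑' i, (normSq (comp (sqrtVec b Γ i)) + photonEnergy (sqrtVec b Γ i)) < ⊤ := by
    rw [ENNReal.tsum_add, hΓ.tsum_normSq]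
    exact ENNReal.add_lt_top.2 ⟨ENNReal.one_lt_top, hi.2.2.2⟩
  exact ((hi.summable_internalForm.hasSum.add
    (hasSum_multExpect_externalEnergy b Γ hv hvρ)).sub
      (hasSum_integral_inner_fieldExpect b Γ hS hJ.continuous)).tsum_eq

/-! ### The exchange of ground states. -/

/-- The potential and current terms of the energy of `Γ` are functionals of `ρ` and `A` alone. -/
theorem energy_eq_of_yields {ι : Type*} [Countable ι] {b : HilbertBasis ι ℂ P.Space}
    {Γ : P.Space →L[ℂ] P.Space} {v : P.Torus → ℝ} (hv : AEMeasurable v)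
    {J : P.Torus → EuclideanSpace ℝ (Fin 3)} (hJ : IsExternalCurrent J)
    (hΓ : IsDensityMatrix b Γ) (h : HasFiniteEnergy b Γ v) {ρ : P.Torus → ENNReal}
    {A : P.Torus → EuclideanSpace ℝ (Fin 3)} (hy : Yields b Γ ρ A) :
    energy b Γ v J = ∑' i, internalForm (sqrtVec b Γ i) +
      ((∫⁻ r, ENNReal.ofReal (v r) * ρ r).toReal -
        (∫⁻ r, ENNReal.ofReal (-v r) * ρ r).toReal) - ∫ r, inner ℝ (J r) (A r) := by
  have h1 : ∀ w : P.Torus → ENNReal, ∫⁻ r, w r * density b Γ r = ∫⁻ r, w r * ρ r := fun w =>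
    lintegral_congr_ae (hy.1.mono fun r hr => by simp only [hr])
  have h2 : ∫ r, inner ℝ (J r) (vectorPotentialExpect b Γ r) = ∫ r, inner ℝ (J r) (A r) :=
    integral_congr_ae (hy.2.mono fun r hr => by simp only [hr])
  rw [energy_eq hv hJ hΓ h, h1, h1, h2]

/-- The internal part is inherited from `h`; the finiteness of ∫ |v'| ρ is borrowed from `Γ'`, which
has the same density. -/
theorem HasFiniteEnergy.of_yields {ι : Type*} [Countable ι] {b : HilbertBasis ι ℂ P.Space}
    {Γ Γ' : P.Space →L[ℂ] P.Space} {v v' : P.Torus → ℝ} (hv : AEMeasurable v)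
    (hv' : AEMeasurable v') {ρ : P.Torus → ENNReal} {A : P.Torus → EuclideanSpace ℝ (Fin 3)}
    (hy : Yields b Γ ρ A) (hy' : Yields b Γ' ρ A) (h : HasFiniteEnergy b Γ v)
    (h' : HasFiniteEnergy b Γ' v') : HasFiniteEnergy b Γ v' := by
  refine (hasFiniteEnergy_iff b Γ hv').2 ⟨((hasFiniteEnergy_iff b Γ hv).1 h).1, ?_⟩
  refine lt_of_eq_of_lt (lintegral_congr_ae ?_) ((hasFiniteEnergy_iff b Γ' hv').1 h').2
  filter_upwards [hy.1, hy'.1] with r hr hr'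
  rw [hr, hr']

theorem IsGroundState.of_yields {ι : Type*} [Countable ι] {b : HilbertBasis ι ℂ P.Space}
    {v₁ v₂ : P.Torus → ℝ} (hv₁ : AEMeasurable v₁) (hv₂ : AEMeasurable v₂)
    {J₁ J₂ : P.Torus → EuclideanSpace ℝ (Fin 3)}
    (hJ₁ : IsExternalCurrent J₁) (hJ₂ : IsExternalCurrent J₂)
    {Γ₁ Γ₂ : P.Space →L[ℂ] P.Space}
    (hΓ₁ : IsGroundState b Γ₁ v₁ J₁) (hΓ₂ : IsGroundState b Γ₂ v₂ J₂)
    {ρ : P.Torus → ENNReal} {A : P.Torus → EuclideanSpace ℝ (Fin 3)}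
    (h₁ : Yields b Γ₁ ρ A) (h₂ : Yields b Γ₂ ρ A) : IsGroundState b Γ₁ v₂ J₂ := by
  obtain ⟨hd₁, hf₁, hm₁⟩ := hΓ₁
  obtain ⟨hd₂, hf₂, hm₂⟩ := hΓ₂
  have hf₁₂ : HasFiniteEnergy b Γ₁ v₂ := .of_yields hv₁ hv₂ h₁ h₂ hf₁ hf₂
  have hf₂₁ : HasFiniteEnergy b Γ₂ v₁ := .of_yields hv₂ hv₁ h₂ h₁ hf₂ hf₁
  -- As `Γ₂` is minimal for (v₂, J₂), it is enough to compare `Γ₁` with `Γ₂`.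
  refine ⟨hd₁, hf₁₂, fun Γ' hd' hf' => le_trans ?_ (hm₂ Γ' hd' hf')⟩
  -- `Γ₂` serves as trial state for (v₁, J₁); once the common external terms cancel, only the
  -- comparison of internal energies remains.
  have h := hm₁ Γ₂ hd₂ hf₂₁
  rw [energy_eq_of_yields hv₁ hJ₁ hd₁ hf₁ h₁, energy_eq_of_yields hv₁ hJ₁ hd₂ hf₂₁ h₂] at h
  rw [energy_eq_of_yields hv₂ hJ₂ hd₁ hf₁₂ h₁, energy_eq_of_yields hv₂ hJ₂ hd₂ hf₂ h₂]
  linarith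

end PauliFierzSystem

end

theorem mainTheorem5 (P : PauliFierzSystem) {ι : Type*} [Countable ι]
    (b : HilbertBasis ι ℂ P.Space)
    (v₁ v₂ : P.Torus → ℝ) (hv₁ : AEMeasurable v₁) (hv₂ : AEMeasurable v₂)
    (J₁ J₂ : P.Torus → EuclideanSpace ℝ (Fin 3))
    (hJ₁ : PauliFierzSystem.IsExternalCurrent J₁) (hJ₂ : PauliFierzSystem.IsExternalCurrent J₂)
    (Γ₁ Γ₂ : P.Space →L[ℂ] P.Space)
    (hΓ₁ : PauliFierzSystem.IsGroundState b Γ₁ v₁ J₁)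
    (hΓ₂ : PauliFierzSystem.IsGroundState b Γ₂ v₂ J₂)
    (ρ : P.Torus → ENNReal) (A : P.Torus → EuclideanSpace ℝ (Fin 3))
    (h₁ : PauliFierzSystem.Yields b Γ₁ ρ A) (h₂ : PauliFierzSystem.Yields b Γ₂ ρ A) :
    PauliFierzSystem.IsGroundState b Γ₁ v₂ J₂ ∧ PauliFierzSystem.IsGroundState b Γ₂ v₁ J₁ :=
  ⟨.of_yields hv₁ hv₂ hJ₁ hJ₂ hΓ₁ hΓ₂ h₁ h₂, .of_yields hv₂ hv₁ hJ₂ hJ₁ hΓ₂ hΓ₁ h₂ h₁⟩
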